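/- Let $F$ be a field and let $G$ and $H$ be matrices over $F$ with $n$ columns, indexed $0,\dots,n-1$, whose row spaces are orthogonal complements of each other in $F^n$. A vector $c\in F^n$ has span $(i,j]$ if $c_i\ne 0$, $c_j\neq 0$ and $c_k=0$ for every $k$ outside the closed cyclic interval from $i$ forward to $j$. The length of the span is $j-i$ if $i\le j$ and $n-(i-j)$ if $j<i$. A characteristic matrix for $G$ is an $n\times n$ matrix whose rows lie in the row space of $G$ and have spans that start in distinct positions and end in distinct positions, such that the sum of the spanlengths is minimal among all such systems of $n$ vectors in the row space. Let $X$ be a left-ordered characteristic matrix for $G$ (row $i$ has span $(i,b_i]$) and $Y$ a right-ordered characteristic matrix for $H$ (row $j$ has span $(a_j,j]$). Write $X=X_0+X_1$ with $X_0$ upper triangular and $X_1$ strictly lower triangular, and $Y=Y_1+Y_0$ with $Y_1$ strictly upper triangular and $Y_0$ lower triangular. Assume that $X$ and $Y$ are in duality, i.e. $X_0Y_1^T+X_1Y_0^T=I$. Put $D=X_0Y_1^T$ and $E=Y_0X_1^T$. Given a matrix $A$ whose rows are edge labelings $c$ with chosen spans $(a,b]$, and a matrix $B$ with columns $h_0,\dots,h_{n-1}$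 and $AB^T=0$, the span based (Nori--Shankar) tail-biting BCJR construction labels the vertices of the path with edge labels $c$ by $v_0=-\sum_{l<a}c_lh_l$ and $v_{k+1}=v_k+c_kh_k$. The trellis is the linear trellis generated by these paths: its vertex space $V_k$ is spanned by the labels $v_k$, and its space of edges from $V_k$ to $V_{k+1}$ is spanned by the triples $(v_k,c_k,v_{k+1})$. The matrix of the initial labels $v_0$ is its displacement matrix. Two linear tail-biting trellises, with vertex spaces $V_k,V_k'$ and edge spaces $B_k,B_k'$, are (locally) dual if there are nondegenerate pairings $\beta_k:V_k\times V'_k\to F$ for $0\le k\le n$, with $\beta_n=\beta_0$, such that for every $k<n$ the space $B'_k$ consists of exactly those $(w,d,w')\in V'_k\times F\times V'_{k+1}$ for which $\beta_k(v,w)+cd-\beta_{k+1}(v',w')=0$ for all $(v,c,v')\in B_k$. Let $I\subseteq\{0,\dots,n-1\}$ and let $J$ be its complement. Then: (1) The rows $I$ of $X$ form a basis for the row space of $X$ if and only if the rows $J$ of $Y$ form a basis for the row space of $Y$. (2) If the rows $I$ of $X$ form a basis for the row space of $X$, let $T$ be the span based BCJR trellis constructed from the rows $I$ of $X$ with the columns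 of the rows $J$ of $Y$ as the vectors $h_k$, and let $T'$ be the one constructed from the rows $J$ of $Y$ with the columns of the rows $I$ of $X$ as the vectors $h_k$. In both constructions the paths are tail-biting ($v_n=v_0$), and $v_k=0$ whenever $0\le k<n$ and $k$ is not in the half-open cyclic interval $(a,b]$ of the path (empty for $a=b$). The displacement matrices of $T$ and $T'$ are $-E[J\times I]^T$ and $D[I\times J]^T$, respectively, and $$E[J\times I]^T=-D[I\times J],$$ so that the displacement matrix of $T'$ is the transpose of that of $T$ (the trellises are in duality as BCJR trellises). Moreover, $T$ and $T'$ are locally dual trellises. -/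

import Mathlib

/-! ### Row spaces and orthogonality -/

/-- The row space of a matrix. -/
def rowSpace {F ι : Type*} [Field F] {n : ℕ} (M : Matrix ι (Fin n) F) :
    Submodule F (Fin n → F) :=
  Submodule.span F (Set.range fun i => M i)

/-- `G` and `H` have maximal orthogonal row spaces: the row space of `H` is the full orthogonal
complement of the row space of `G` for the standard bilinear form. -/
def MaximalOrthogonal {F ι κ : Type*} [Field F] {n : ℕ}
    (G : Matrix ι (Fin n) F) (H : Matrix κ (Fin n) F) : Prop :=
  ∀ d : Fin n → F, d ∈ rowSpace H ↔ ∀ c ∈ rowSpace G, c ⬝ᵥ d = 0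

/-- The rows of `M` with index in `I` form a basis for the row space of `M`. -/
def IsRowBasis {F : Type*} [Field F] {n : ℕ} (M : Matrix (Fin n) (Fin n) F)
    (I : Finset (Fin n)) : Prop :=
  LinearIndependent F (fun i : I => M i) ∧
    Submodule.span F (Set.range fun i : I => M i) = rowSpace M

/-- The submatrix of the rows with index in `I`. -/
def rowsOf {F : Type*} {n : ℕ} (M : Matrix (Fin n) (Fin n) F) (I : Finset (Fin n)) :
    Matrix I (Fin n) F :=
  M.submatrix (fun i => (i : Fin n)) id

/-- The submatrix `M[I × J]`. -/
def minorOf {F : Type*} {n : ℕ} (M : Matrix (Fin n) (Fin n) F) (I J : Finset (Fin n)) :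
    Matrix I J F :=
  M.submatrix (fun i => (i : Fin n)) (fun j => (j : Fin n))

/-! ### Spans and characteristic matrices -/

/-- `k` lies in the cyclic interval `(i, j]` of `{0, …, n - 1}`: the positions after `i`, going
forward (and around) up to and including `j`. It is empty for `i = j`. -/
def InCyclicIoc {n : ℕ} (i j k : Fin n) : Prop :=
  if i ≤ j then i < k ∧ k ≤ j else i < k ∨ k ≤ j

/-- The length of the span `(i, j]`: `j - i` for `i ≤ j` and `n - (i - j)` for `j < i`. -/
def spanLength {n : ℕ} (i j : Fin n) : ℕ :=
  if i ≤ j then j.val - i.val else n - (i.val - j.val)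

/-- The vector `c` has span `(i, j]`: it is nonzero in its starting position `i` and in its ending
position `j`, and it vanishes outside the cyclic interval from `i` to `j`. -/
def HasSpan {F : Type*} [Field F] {n : ℕ} (c : Fin n → F) (i j : Fin n) : Prop :=
  c i ≠ 0 ∧ c j ≠ 0 ∧ ∀ k, k ≠ i → ¬ InCyclicIoc i j k → c k = 0

/-- The rows of `X` are `n` vectors in `C`, with spans `(a i, b i]` that start in distinct positions
and end in distinct positions. -/
structure IsSpanSystem {F : Type*} [Field F] {n : ℕ} (C : Submodule F (Fin n → F))
    (X : Matrix (Fin n) (Fin n) F) (a b : Fin n → Fin n) : Prop where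
  mem : ∀ i, X i ∈ C
  start_injective : Function.Injective a
  end_injective : Function.Injective b
  hasSpan : ∀ i, HasSpan (X i) (a i) (b i)

/-- The rows of `X`, with the spans `(a i, b i]`, form a set of characteristic generators for `C`:
the sum of the spanlengths is minimal. That is, `X` is a characteristic matrix with row space
`C` and with spans `(a i, b i]`. -/
structure IsCharacteristic {F : Type*} [Field F] {n : ℕ} (C : Submodule F (Fin n → F))
    (X : Matrix (Fin n) (Fin n) F) (a b : Fin n → Fin n) : Prop
    extends IsSpanSystem C X a b where
  minimal : ∀ (X' : Matrix (Fin n) (Fin n) F) (a' b' : Fin n → Fin n),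
    IsSpanSystem C X' a' b' →
      ∑ i, spanLength (a i) (b i) ≤ ∑ i, spanLength (a' i) (b' i)

/-- `X` is a left-ordered characteristic matrix for `C`, with spans `(i, b i]`: every row has its
span starting on the diagonal. -/
def IsLeftOrderedCharacteristic {F : Type*} [Field F] {n : ℕ} (C : Submodule F (Fin n → F))
    (X : Matrix (Fin n) (Fin n) F) (b : Fin n → Fin n) : Prop :=
  IsCharacteristic C X id b

/-- `Y` is a right-ordered characteristic matrix for `C`, with spans `(a j, j]`: every row has its
span ending on the diagonal. -/
def IsRightOrderedCharacteristic {F : Type*} [Field F] {n : ℕ} (C : Submodule F (Fin n → F))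
    (Y : Matrix (Fin n) (Fin n) F) (a : Fin n → Fin n) : Prop :=
  IsCharacteristic C Y a id

/-- The upper triangular part `X₀` in `X = X₀ + X₁`. -/
def upperPart {F : Type*} [Field F] {n : ℕ} (X : Matrix (Fin n) (Fin n) F) :
    Matrix (Fin n) (Fin n) F :=
  Matrix.of fun i j => if i ≤ j then X i j else 0

/-- The strictly lower triangular part `X₁` in `X = X₀ + X₁`. -/
def strictLowerPart {F : Type*} [Field F] {n : ℕ} (X : Matrix (Fin n) (Fin n) F) :
    Matrix (Fin n) (Fin n) F :=
  Matrix.of fun i j => if j < i then X i j else 0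

/-- The lower triangular part `Y₀` in `Y = Y₁ + Y₀`. -/
def lowerPart {F : Type*} [Field F] {n : ℕ} (Y : Matrix (Fin n) (Fin n) F) :
    Matrix (Fin n) (Fin n) F :=
  Matrix.of fun i j => if j ≤ i then Y i j else 0

/-- The strictly upper triangular part `Y₁` in `Y = Y₁ + Y₀`. -/
def strictUpperPart {F : Type*} [Field F] {n : ℕ} (Y : Matrix (Fin n) (Fin n) F) :
    Matrix (Fin n) (Fin n) F :=
  Matrix.of fun i j => if i < j then Y i j else 0

/-- Duality of (a left-ordered) `X` and (a right-ordered) `Y`: `X₀ Y₁ᵀ + X₁ Y₀ᵀ = I`. -/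
def InDuality {F : Type*} [Field F] {n : ℕ} (X Y : Matrix (Fin n) (Fin n) F) : Prop :=
  upperPart X * (strictUpperPart Y).transpose +
    strictLowerPart X * (lowerPart Y).transpose = 1

/-- The matrix `D = X₀ Y₁ᵀ`. -/
def displacementD {F : Type*} [Field F] {n : ℕ} (X Y : Matrix (Fin n) (Fin n) F) :
    Matrix (Fin n) (Fin n) F :=
  upperPart X * (strictUpperPart Y).transpose

/-- The matrix `E = Y₀ X₁ᵀ`. -/
def displacementE {F : Type*} [Field F] {n : ℕ} (X Y : Matrix (Fin n) (Fin n) F) :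
    Matrix (Fin n) (Fin n) F :=
  lowerPart Y * (strictLowerPart X).transpose

/-! ### Linear tail-biting trellises -/

/-- A linear tail-biting trellis of length `n` over `F`: vertex spaces `V 0, …, V n` (subspaces of a
common space `W`) with `V n` and `V 0` identified, and linear spaces of labeled edges
`(v, c, v')` from `V k` to `V (k + 1)`. -/
structure LinearTrellis (F : Type*) [Field F] (n : ℕ) (W : Type*) [AddCommGroup W]
    [Module F W] where
  V : Fin (n + 1) → Submodule F W
  edges : Fin n → Submodule F (W × F × W)
  tailBiting : V (Fin.last n) = V 0
  source_mem : ∀ k, ∀ e ∈ edges k, e.1 ∈ V k.castSucc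
  target_mem : ∀ k, ∀ e ∈ edges k, e.2.2 ∈ V k.succ

/-- (Local) trellis duality: after choosing nondegenerate pairings `β k` between the vertex spaces
`V k` and `V' k` (the same pairing at time `n` as at time `0`), each edge space of the second
trellis is the full orthogonal space of the corresponding edge space of the first trellis, where
edges `(v, c, v')` and `(w, d, w')` are orthogonal if `β(v, w) + c d - β(v', w') = 0`. The pairings
are given as bilinear forms on the ambient spaces; only their restrictions matter. -/
def LinearTrellis.IsDual {F : Type*} [Field F] {n : ℕ} {W W' : Type*}
    [AddCommGroup W] [Module F W] [AddCommGroup W'] [Module F W']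
    (T : LinearTrellis F n W) (T' : LinearTrellis F n W') : Prop :=
  ∃ β : Fin (n + 1) → W →ₗ[F] W' →ₗ[F] F,
    β (Fin.last n) = β 0 ∧
    (∀ k, ∀ v ∈ T.V k, (∀ w ∈ T'.V k, β k v w = 0) → v = 0) ∧
    (∀ k, ∀ w ∈ T'.V k, (∀ v ∈ T.V k, β k v w = 0) → w = 0) ∧
    ∀ (k : Fin n) (e' : W' × F × W'), e' ∈ T'.edges k ↔
      e'.1 ∈ T'.V k.castSucc ∧ e'.2.2 ∈ T'.V k.succ ∧
        ∀ e ∈ T.edges k,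
          β k.castSucc e.1 e'.1 + e.2.1 * e'.2.1 - β k.succ e.2.2 e'.2.2 = 0

/-! ### The tail-biting BCJR construction -/

/-- The vertex labels in the BCJR construction. The rows of `A` are the edge labelings of the
generating paths, the columns of `B` are the parity-check vectors `h 0, …, h (n - 1)`, and the rows
of the displacement matrix `Θ` are the labels of the initial vertices. Row `i` of the `k`-th matrix
is the label of vertex `k` on path `i`, namely `v k = v 0 + ∑_{l < k} c l • h l`. -/
def bcjrLabels {F ι κ : Type*} [Field F] {n : ℕ} (A : Matrix ι (Fin n) F)
    (B : Matrix κ (Fin n) F) (Θ : Matrix ι κ F) (k : Fin (n + 1)) : Matrix ι κ F :=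
  Matrix.of fun i j => Θ i j + ∑ l : Fin n, if l.castSucc < k then A i l * B j l else 0

theorem bcjrLabels_last {F ι κ : Type*} [Field F] {n : ℕ} (A : Matrix ι (Fin n) F)
    (B : Matrix κ (Fin n) F) (Θ : Matrix ι κ F) (h : A * B.transpose = 0) :
    bcjrLabels A B Θ (Fin.last n) = bcjrLabels A B Θ 0 := by
  ext i j
  have hij : ∑ l, A i l * B j l = 0 := by
    simpa [Matrix.mul_apply] using congrFun (congrFun h i) j
  simp [bcjrLabels, hij, Fin.castSucc_lt_last]

/-- The tail-biting BCJR trellis with edge labelings `A`, parity checks `B` (orthogonal to `A`) and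
displacement matrix `Θ`: the linear trellis whose label code is generated by the paths of
`bcjrLabels`. -/
def bcjrTrellis {F ι κ : Type*} [Field F] [Fintype ι] {n : ℕ} (A : Matrix ι (Fin n) F)
    (B : Matrix κ (Fin n) F) (Θ : Matrix ι κ F) (h : A * B.transpose = 0) :
    LinearTrellis F n (κ → F) where
  V k := LinearMap.range (bcjrLabels A B Θ k).vecMulLinear
  edges k := LinearMap.range
    ((bcjrLabels A B Θ k.castSucc).vecMulLinear.prod
      ((Fintype.linearCombination F fun i => A i k).prod
        (bcjrLabels A B Θ k.succ).vecMulLinear))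
  tailBiting := by rw [bcjrLabels_last A B Θ h]
  source_mem := by
    rintro k e ⟨u, rfl⟩
    exact ⟨u, rfl⟩
  target_mem := by
    rintro k e ⟨u, rfl⟩
    exact ⟨u, rfl⟩

/-- The displacement matrix of the span based BCJR construction: the initial label of path `i`, with
span `(a i, b i]`, is chosen such that the accumulated label is zero at the vertex `a i` where
the span starts. -/
def spanDisplacement {F ι κ : Type*} [Field F] {n : ℕ} (A : Matrix ι (Fin n) F)
    (B : Matrix κ (Fin n) F) (a : ι → Fin n) : Matrix ι κ F :=
  Matrix.of fun i j => - ∑ l : Fin n, if l < a i then A i l * B j l else 0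

/-- The rules of the span based BCJR construction for a system of vertex labels `N`: the labels
follow `v (k + 1) = v k + c k • h k`, the paths are tail-biting, and the label of vertex `k` on
path `i` is zero whenever `k` is not in the span `(a i, b i]`. -/
structure IsSpanLabeling {F ι κ : Type*} [Field F] {n : ℕ} (A : Matrix ι (Fin n) F)
    (B : Matrix κ (Fin n) F) (a b : ι → Fin n) (N : Fin (n + 1) → Matrix ι κ F) : Prop where
  step : ∀ (k : Fin n) (i : ι) (j : κ), N k.succ i j = N k.castSucc i j + A i k * B j k
  tailBiting : N (Fin.last n) = N 0
  vanish : ∀ (i : ι) (k : Fin n), ¬ InCyclicIoc (a i) (b i) k → N k.castSucc i = 0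

/-! ### The trellises for a pair of characteristic matrices -/

theorem rowsOf_mul_transpose {F ι κ : Type*} [Field F] {n : ℕ} {G : Matrix ι (Fin n) F}
    {H : Matrix κ (Fin n) F} (hGH : MaximalOrthogonal G H) {X Y : Matrix (Fin n) (Fin n) F}
    {a b : Fin n → Fin n} (hX : IsLeftOrderedCharacteristic (rowSpace G) X b)
    (hY : IsRightOrderedCharacteristic (rowSpace H) Y a) (I J : Finset (Fin n)) :
    rowsOf X I * (rowsOf Y J).transpose = 0 := by
  ext i j
  exact (hGH (Y j)).1 (hY.mem j) (X i) (hX.mem i)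

theorem rowsOf_mul_transpose' {F ι κ : Type*} [Field F] {n : ℕ} {G : Matrix ι (Fin n) F}
    {H : Matrix κ (Fin n) F} (hGH : MaximalOrthogonal G H) {X Y : Matrix (Fin n) (Fin n) F}
    {a b : Fin n → Fin n} (hX : IsLeftOrderedCharacteristic (rowSpace G) X b)
    (hY : IsRightOrderedCharacteristic (rowSpace H) Y a) (I J : Finset (Fin n)) :
    rowsOf Y J * (rowsOf X I).transpose = 0 := by
  have h := congrArg Matrix.transpose (rowsOf_mul_transpose hGH hX hY I J)
  simpa [Matrix.transpose_mul] using h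

/-- The displacement matrix (indexed by `I × J`) of the span based BCJR construction for the rows
`I` of the left-ordered matrix `X`, with row `i` having its span start in `i`, and with the columns
of the rows `J` of `Y` as parity checks. -/
def thetaX {F : Type*} [Field F] {n : ℕ} (X Y : Matrix (Fin n) (Fin n) F)
    (I J : Finset (Fin n)) : Matrix I J F :=
  spanDisplacement (rowsOf X I) (rowsOf Y J) (fun i => (i : Fin n))

/-- The displacement matrix (indexed by `J × I`) of the span based BCJR construction for the rows
`J` of the right-ordered matrix `Y`, with row `j` having its span start in `a j`, and with the
columns of the rows `I` of `X` as parity checks. -/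
def thetaY {F : Type*} [Field F] {n : ℕ} (X Y : Matrix (Fin n) (Fin n) F)
    (a : Fin n → Fin n) (I J : Finset (Fin n)) : Matrix J I F :=
  spanDisplacement (rowsOf Y J) (rowsOf X I) (fun j => a j)

/-!
Write `X = X₀ + X₁` and `Y = Y₁ + Y₀` for the triangular parts. As the rows of `X` and `Y` are
orthogonal, `X * Yᵀ = 0`, and subtracting the duality relation `X₀ * Y₁ᵀ + X₁ * Y₀ᵀ = 1` leaves
`X₀ * Y₀ᵀ + X₁ * Y₁ᵀ = -1`. The first summand is upper and the second strictly lower triangular, so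
`X₀ * Y₀ᵀ = -1` and `X₁ * Y₁ᵀ = 0`. Hence `D = -X * Y₀ᵀ` and `Eᵀ = -X₀ * Yᵀ`, where `Y₀ᵀ` and `-X₀`
are inverse to each other, and `D + Eᵀ = 1`, so that `D` and `Eᵀ` are complementary projections
and `Yᵀ * X = 0` (`InDuality.transpose_mul_eq_zero`).

*Rank duality.* It follows that the linear relations between the rows of `X` are precisely the
column space of `Y`, and conversely. So the rows `I` of `X` are independent if and only if a vector
of the column space of `Y` that vanishes on `Iᶜ` is zero, which says that the rows `Iᶜ` of `Y` span
the row space (`linearIndependent_rows_iff`).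

*Displacement matrices.* The partial sums that define them are entries of `X₁ * Yᵀ = Eᵀ` and of
`Y₀ * Xᵀ = -Dᵀ`, and off the diagonal `Eᵀ` and `-D` agree.

*Local duality.* As the displacement matrices are transposes of each other, the vertex labels at
time `k` are the rows of a matrix `N k` for the first trellis and its columns for the second one, and
`β (u * N k) (N k * x) = u * N k * x` is a nondegenerate pairing of the vertex spaces. With
`N (k + 1) = N k + A k * (B k)ᵀ` the edges of the two trellises are orthogonal. An edge space of the
second trellis is the full orthogonal space unless `A k` is in the column spaces and `B k` in the row
spaces of both `N k` and `N (k + 1)` (`isDual_bcjrTrellis` uses a convenient sufficient condition).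
This exception does not occur here: if `k ∈ I`, a path of the first trellis has its span starting in
`k`, and row `k` of `N k` vanishes while `A k` does not vanish there; if `k ∉ I`, a path of the second
trellis has its span ending in `k`, and column `k` of `N (k + 1)` vanishes while `B k` does not
vanish there.
-/

open Matrix

/-! ### Triangular parts of matrices in duality -/

section Triangular

variable {F : Type*} [Field F] {n : ℕ} {X Y : Matrix (Fin n) (Fin n) F}

theorem upperPart_add_strictLowerPart (X : Matrix (Fin n) (Fin n) F) :
    upperPart X + strictLowerPart X = X := by
  ext i j
  by_cases h : i ≤ j
  · simp [upperPart, strictLowerPart, h, not_lt.2 h]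
  · simp [upperPart, strictLowerPart, h, not_le.1 h]

theorem strictUpperPart_add_lowerPart (Y : Matrix (Fin n) (Fin n) F) :
    strictUpperPart Y + lowerPart Y = Y := by
  ext i j
  by_cases h : j ≤ i
  · simp [strictUpperPart, lowerPart, h, not_lt.2 h]
  · simp [strictUpperPart, lowerPart, h, not_le.1 h]

theorem upperPart_mul_lowerPart_apply_of_lt {i j : Fin n} (h : j < i) :
    (upperPart X * (lowerPart Y)ᵀ) i j = 0 := by
  rw [mul_apply]
  refine Finset.sum_eq_zero fun l _ => ?_
  by_cases hl : i ≤ l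
  · simp [lowerPart, not_le.2 (h.trans_le hl)]
  · simp [upperPart, hl]

theorem strictLowerPart_mul_strictUpperPart_apply_of_le {i j : Fin n} (h : i ≤ j) :
    (strictLowerPart X * (strictUpperPart Y)ᵀ) i j = 0 := by
  rw [mul_apply]
  refine Finset.sum_eq_zero fun l _ => ?_
  by_cases hl : l < i
  · simp [strictUpperPart, not_lt.2 (hl.le.trans h)]
  · simp [strictLowerPart, hl]

/-- `X * Yᵀ = 0` minus the duality relation. -/
theorem InDuality.remaining_parts (hd : InDuality X Y) (h0 : X * Yᵀ = 0) :
    upperPart X * (lowerPart Y)ᵀ + strictLowerPart X * (strictUpperPart Y)ᵀ = -1 := by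
  have h : (upperPart X + strictLowerPart X) * (strictUpperPart Y + lowerPart Y)ᵀ = 0 := by
    rwa [upperPart_add_strictLowerPart, strictUpperPart_add_lowerPart]
  have hd' : upperPart X * (strictUpperPart Y)ᵀ + strictLowerPart X * (lowerPart Y)ᵀ = 1 := hd
  rw [transpose_add, add_mul, mul_add, mul_add] at h
  rw [eq_neg_iff_add_eq_zero, ← hd', ← h]
  abel

theorem InDuality.upperPart_mul_lowerPart (hd : InDuality X Y) (h0 : X * Yᵀ = 0) :
    upperPart X * (lowerPart Y)ᵀ = -1 := by
  ext i j
  rcases le_or_gt i j with h | h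
  · rw [← hd.remaining_parts h0, Matrix.add_apply,
      strictLowerPart_mul_strictUpperPart_apply_of_le h, add_zero]
  · rw [upperPart_mul_lowerPart_apply_of_lt h, Matrix.neg_apply, one_apply_ne h.ne', neg_zero]

theorem InDuality.strictLowerPart_mul_strictUpperPart (hd : InDuality X Y) (h0 : X * Yᵀ = 0) :
    strictLowerPart X * (strictUpperPart Y)ᵀ = 0 := by
  have h := hd.remaining_parts h0
  rwa [hd.upperPart_mul_lowerPart h0, add_eq_left] at h

theorem InDuality.lowerPart_mul_upperPart (hd : InDuality X Y) (h0 : X * Yᵀ = 0) :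
    (lowerPart Y)ᵀ * upperPart X = -1 := by
  have h : -upperPart X * (lowerPart Y)ᵀ = 1 := by
    rw [neg_mul, hd.upperPart_mul_lowerPart h0, neg_neg]
  have h' := mul_eq_one_comm.1 h
  rwa [mul_neg, neg_eq_iff_eq_neg] at h'

theorem InDuality.displacementD_add (hd : InDuality X Y) :
    displacementD X Y + (displacementE X Y)ᵀ = 1 := by
  rw [displacementE, transpose_mul, transpose_transpose]
  exact hd

theorem InDuality.mul_lowerPart (hd : InDuality X Y) (h0 : X * Yᵀ = 0) :
    X * (lowerPart Y)ᵀ = -displacementD X Y := by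
  have h : (upperPart X + strictLowerPart X) * (lowerPart Y)ᵀ = X * (lowerPart Y)ᵀ := by
    rw [upperPart_add_strictLowerPart]
  have hd' : displacementD X Y + strictLowerPart X * (lowerPart Y)ᵀ = 1 := hd
  rw [← h, add_mul, hd.upperPart_mul_lowerPart h0, ← hd']
  abel

theorem InDuality.strictLowerPart_mul (hd : InDuality X Y) (h0 : X * Yᵀ = 0) :
    strictLowerPart X * Yᵀ = (displacementE X Y)ᵀ := by
  have h : strictLowerPart X * (strictUpperPart Y + lowerPart Y)ᵀ = strictLowerPart X * Yᵀ := by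
    rw [strictUpperPart_add_lowerPart]
  rw [← h, transpose_add, mul_add, hd.strictLowerPart_mul_strictUpperPart h0, zero_add,
    displacementE, transpose_mul, transpose_transpose]

theorem InDuality.upperPart_mul (hd : InDuality X Y) (h0 : X * Yᵀ = 0) :
    upperPart X * Yᵀ = -(displacementE X Y)ᵀ := by
  rw [← hd.strictLowerPart_mul h0, eq_neg_iff_add_eq_zero, ← add_mul,
    upperPart_add_strictLowerPart, h0]

theorem InDuality.mul_add_mul (hd : InDuality X Y) (h0 : X * Yᵀ = 0) :
    X * (lowerPart Y)ᵀ + upperPart X * Yᵀ = -1 := by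
  rw [hd.mul_lowerPart h0, hd.upperPart_mul h0, ← hd.displacementD_add, neg_add]

/-- The columns of `Y` are relations between the rows of `X`. -/
theorem InDuality.transpose_mul_eq_zero (hd : InDuality X Y) (h0 : X * Yᵀ = 0) :
    Yᵀ * X = 0 := by
  have hQP := hd.lowerPart_mul_upperPart h0
  have hsum := hd.mul_add_mul h0
  -- The projections `-X Y₀ᵀ` and `-X₀ Yᵀ` commute, as their sum is one.
  have h : upperPart X * (Yᵀ * X) * (lowerPart Y)ᵀ = 0 :=
    calc upperPart X * (Yᵀ * X) * (lowerPart Y)ᵀ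
        = upperPart X * Yᵀ * (X * (lowerPart Y)ᵀ) := by simp only [mul_assoc]
      _ = X * (lowerPart Y)ᵀ * (upperPart X * Yᵀ) := by
          rw [← eq_sub_iff_add_eq'] at hsum
          rw [hsum]
          noncomm_ring
      _ = X * ((lowerPart Y)ᵀ * upperPart X) * Yᵀ := by simp only [mul_assoc]
      _ = 0 := by rw [hQP, mul_neg, mul_one, neg_mul, h0, neg_zero]
  calc Yᵀ * X
      = (lowerPart Y)ᵀ * upperPart X * (Yᵀ * X) * ((lowerPart Y)ᵀ * upperPart X) := by
        rw [hQP]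
        simp
    _ = (lowerPart Y)ᵀ * (upperPart X * (Yᵀ * X) * (lowerPart Y)ᵀ) * upperPart X := by
        simp only [mul_assoc]
    _ = 0 := by rw [h, mul_zero, zero_mul]

end Triangular

/-! ### Rank duality -/

section RankDuality

variable {F : Type*} [Field F] {n : ℕ}

theorem mem_span_range_iff_dotProduct {ι : Type*} (v : ι → Fin n → F) (y : Fin n → F) :
    y ∈ Submodule.span F (Set.range v) ↔ ∀ w, (∀ i, v i ⬝ᵥ w = 0) → y ⬝ᵥ w = 0 := by
  constructor
  · intro hy w hw
    induction hy using Submodule.span_induction with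
    | mem x hx => obtain ⟨i, rfl⟩ := hx; exact hw i
    | zero => exact zero_dotProduct w
    | add x z _ _ hx hz => rw [add_dotProduct, hx, hz, add_zero]
    | smul t x _ hx => rw [smul_dotProduct, hx, smul_zero]
  · intro h
    by_contra hy
    obtain ⟨f, hfy, hf⟩ := Submodule.exists_le_ker_of_notMem hy
    have hfw : ∀ x, x ⬝ᵥ (fun i => f (Pi.single i 1)) = f x := fun x => by
      conv_rhs => rw [pi_eq_sum_univ' x]
      simp [dotProduct, map_sum]
    refine hfy ?_
    rw [← hfw]
    refine h _ fun i => ?_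
    rw [hfw]
    exact hf (Submodule.subset_span ⟨i, rfl⟩)

theorem span_rows_eq_rowSpace_iff (Y : Matrix (Fin n) (Fin n) F) (J : Finset (Fin n)) :
    Submodule.span F (Set.range fun j : J => Y j) = rowSpace Y ↔
      ∀ w, (∀ j ∈ J, (Y *ᵥ w) j = 0) → Y *ᵥ w = 0 := by
  have hle : Submodule.span F (Set.range fun j : J => Y j) ≤ rowSpace Y :=
    Submodule.span_mono (by rintro _ ⟨j, rfl⟩; exact ⟨j, rfl⟩)
  rw [← hle.ge_iff_eq, rowSpace, Submodule.span_le]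
  constructor
  · intro h w hw
    funext i
    exact (mem_span_range_iff_dotProduct _ _).1 (h ⟨i, rfl⟩) w fun j => hw j j.2
  · rintro h _ ⟨i, rfl⟩
    exact (mem_span_range_iff_dotProduct _ _).2 fun w hw =>
      congrFun (h w fun j hj => hw ⟨j, hj⟩) i

theorem linearIndependent_rows_iff_vecMul (X : Matrix (Fin n) (Fin n) F) (I : Finset (Fin n)) :
    LinearIndependent F (fun i : I => X i) ↔
      ∀ u : Fin n → F, (∀ i ∉ I, u i = 0) → u ᵥ* X = 0 → u = 0 := by
  have hsum : ∀ u : Fin n → F, (∀ i ∉ I, u i = 0) → ∑ i : I, u i • X i = u ᵥ* X := by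
    intro u hu
    rw [vecMul_eq_sum]
    refine (Finset.sum_coe_sort I fun i => u i • X i).trans ?_
    refine Finset.sum_subset (Finset.subset_univ I) fun i _ hi => ?_
    rw [hu i hi, zero_smul]
  rw [Fintype.linearIndependent_iff]
  constructor
  · intro h u hu h0
    funext i
    by_cases hi : i ∈ I
    · exact h (fun i => u i) ((hsum u hu).trans h0) ⟨i, hi⟩
    · exact hu i hi
  · intro h g hg i
    have hu : ∀ i ∉ I, (fun i => if hi : i ∈ I then g ⟨i, hi⟩ else 0) i = 0 :=
      fun i hi => dif_neg hi
    have h0 := h _ hu (by rw [← hsum _ hu]; simpa using hg)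
    simpa using congrFun h0 i

/-- If the relations between the rows of `X` are the column space of `Y`, then a set of rows of `X`
is independent if and only if the complementary rows of `Y` span. -/
theorem linearIndependent_rows_iff {X Y : Matrix (Fin n) (Fin n) F}
    (h : ∀ u, u ᵥ* X = 0 ↔ ∃ w, Y *ᵥ w = u) (I : Finset (Fin n)) :
    LinearIndependent F (fun i : I => X i) ↔
      Submodule.span F (Set.range fun j : (Iᶜ : Finset (Fin n)) => Y j) = rowSpace Y := by
  rw [linearIndependent_rows_iff_vecMul, span_rows_eq_rowSpace_iff]
  constructor
  · intro hI w hw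
    exact hI _ (fun i hi => hw i (Finset.mem_compl.2 hi)) ((h _).2 ⟨w, rfl⟩)
  · intro hJ u hu hX
    obtain ⟨w, rfl⟩ := (h u).1 hX
    exact hJ w fun j hj => hu j (Finset.mem_compl.1 hj)

theorem vecMul_eq_zero_iff_of_mul_add_mul {X Y P Q : Matrix (Fin n) (Fin n) F}
    (hYX : Yᵀ * X = 0) (h : X * P + Q * Yᵀ = -1) (u : Fin n → F) :
    u ᵥ* X = 0 ↔ ∃ w, Y *ᵥ w = u := by
  constructor
  · intro hu
    refine ⟨-(u ᵥ* Q), ?_⟩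
    have h1 := congrArg (u ᵥ* ·) h
    simp only [vecMul_add, ← vecMul_vecMul, hu, zero_vecMul, zero_add, vecMul_neg, vecMul_one,
      vecMul_transpose] at h1
    rw [mulVec_neg, h1, neg_neg]
  · rintro ⟨w, rfl⟩
    rw [← vecMul_transpose, vecMul_vecMul, hYX, vecMul_zero]

theorem InDuality.isRowBasis_iff {X Y : Matrix (Fin n) (Fin n) F} (hd : InDuality X Y)
    (h0 : X * Yᵀ = 0) (I : Finset (Fin n)) : IsRowBasis X I ↔ IsRowBasis Y Iᶜ := by
  have hYX := hd.transpose_mul_eq_zero h0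
  have hXY : Xᵀ * Y = 0 := by simpa using congrArg transpose hYX
  have hsum := hd.mul_add_mul h0
  have hsum' : Y * (upperPart X)ᵀ + lowerPart Y * Xᵀ = -1 := by
    have h := congrArg transpose hsum
    simp only [transpose_add, transpose_mul, transpose_transpose, transpose_neg,
      transpose_one] at h
    rw [← h, add_comm]
  have hX := linearIndependent_rows_iff (vecMul_eq_zero_iff_of_mul_add_mul hYX hsum) I
  have hY := linearIndependent_rows_iff (vecMul_eq_zero_iff_of_mul_add_mul hXY hsum') Iᶜ
  rw [compl_compl] at hY
  rw [IsRowBasis, IsRowBasis, hX, hY, and_comm]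

end RankDuality

/-! ### Span based labelings -/

section SpanLabeling

variable {F ι κ : Type*} [Field F] {n : ℕ}

theorem bcjrLabels_succ (A : Matrix ι (Fin n) F) (B : Matrix κ (Fin n) F) (Θ : Matrix ι κ F)
    (k : Fin n) (i : ι) (j : κ) :
    bcjrLabels A B Θ k.succ i j = bcjrLabels A B Θ k.castSucc i j + A i k * B j k := by
  have h : ∀ l : Fin n, (if l.castSucc < k.succ then A i l * B j l else 0) =
      (if l.castSucc < k.castSucc then A i l * B j l else 0) +
        if l = k then A i l * B j l else 0 := by
    intro l
    rcases lt_trichotomy l k with hl | rfl | hl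
    · simp [hl, hl.ne, Fin.castSucc_lt_succ_iff, hl.le]
    · simp [Fin.castSucc_lt_succ_iff]
    · simp [hl.ne', Fin.castSucc_lt_succ_iff, not_le.2 hl, not_lt.2 hl.le]
  simp only [bcjrLabels, of_apply, h, Finset.sum_add_distrib, Finset.sum_ite_eq',
    Finset.mem_univ, if_true, add_assoc]

theorem bcjrLabels_transpose (A : Matrix ι (Fin n) F) (B : Matrix κ (Fin n) F)
    (Θ : Matrix ι κ F) (k : Fin (n + 1)) :
    bcjrLabels B A Θᵀ k = (bcjrLabels A B Θ k)ᵀ := by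
  ext j i
  simp [bcjrLabels, mul_comm]

theorem HasSpan.sum_lt_eq {c d : Fin n → F} {a b k : Fin n} (hc : HasSpan c a b)
    (h0 : c ⬝ᵥ d = 0) (hk : ¬ InCyclicIoc a b k) :
    (∑ l, if l < k then c l * d l else 0) = ∑ l, if l < a then c l * d l else 0 := by
  rcases le_or_gt k a with hka | hka
  · refine Finset.sum_congr rfl fun l _ => ?_
    by_cases hlk : l < k
    · rw [if_pos hlk, if_pos (hlk.trans_le hka)]
    · rw [if_neg hlk]
      split_ifs with hla
      · rw [hc.2.2 l hla.ne, zero_mul]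
        unfold InCyclicIoc at hk ⊢
        split_ifs at hk ⊢ <;> grind
      · rfl
  · -- Only the span itself contains positions after `a`, unless `a ≤ b < k`.
    have hab : a ≤ b ∧ b < k := by
      unfold InCyclicIoc at hk
      split_ifs at hk <;> grind
    trans 0
    · refine Eq.trans ?_ h0
      refine Finset.sum_congr rfl fun l _ => ?_
      split_ifs with hlk
      · rfl
      · rw [hc.2.2 l (by grind), zero_mul]
        unfold InCyclicIoc
        grind
    · symm
      refine Finset.sum_eq_zero fun l _ => ?_
      split_ifs with hla
      · rw [hc.2.2 l hla.ne, zero_mul]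
        unfold InCyclicIoc
        grind
      · rfl

theorem isSpanLabeling_bcjrLabels {A : Matrix ι (Fin n) F} {B : Matrix κ (Fin n) F}
    (h : A * Bᵀ = 0) {a b : ι → Fin n} (hA : ∀ i, HasSpan (A i) (a i) (b i)) :
    IsSpanLabeling A B a b (bcjrLabels A B (spanDisplacement A B a)) where
  step := bcjrLabels_succ A B _
  tailBiting := bcjrLabels_last A B _ h
  vanish i k hk := by
    funext j
    have h0 : A i ⬝ᵥ B j = 0 := congrFun (congrFun h i) j
    simp only [bcjrLabels, spanDisplacement, of_apply, Fin.castSucc_lt_castSucc_iff,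
      (hA i).sum_lt_eq h0 hk, neg_add_cancel, Pi.zero_apply]

end SpanLabeling

/-! ### Local duality of BCJR trellises -/

section LocalDuality

variable {F ι κ : Type*} [Field F] {n : ℕ}

theorem exists_mulVec_generalizedInverse [Fintype κ] (N : Matrix ι κ F) :
    ∃ g : (ι → F) →ₗ[F] κ → F, ∀ x, N *ᵥ g (N *ᵥ x) = N *ᵥ x := by
  obtain ⟨s, hs⟩ := N.mulVecLin.rangeRestrict.exists_rightInverse_of_surjective
    N.mulVecLin.range_rangeRestrict
  obtain ⟨g, hg⟩ := s.exists_extend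
  refine ⟨g, fun x => ?_⟩
  have h1 : g (N *ᵥ x) = s (N.mulVecLin.rangeRestrict x) :=
    LinearMap.congr_fun hg (N.mulVecLin.rangeRestrict x)
  have h2 := congrArg Subtype.val (LinearMap.congr_fun hs (N.mulVecLin.rangeRestrict x))
  rw [h1]
  exact h2

/-- A pairing of the row space of `N` with its column space. -/
theorem exists_pairing_vecMul_mulVec [Fintype ι] [Fintype κ] (N : Matrix ι κ F) :
    ∃ β : (κ → F) →ₗ[F] (ι → F) →ₗ[F] F,
      ∀ u x, β (u ᵥ* N) (N *ᵥ x) = u ⬝ᵥ N *ᵥ x := by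
  obtain ⟨g, hg⟩ := exists_mulVec_generalizedInverse N
  refine ⟨(dotProductBilin F F).compl₂ g, fun u x => ?_⟩
  change (u ᵥ* N) ⬝ᵥ g (N *ᵥ x) = _
  rw [← dotProduct_mulVec, hg]

theorem mem_edges_bcjrTrellis [Fintype ι] {A : Matrix ι (Fin n) F} {B : Matrix κ (Fin n) F}
    {Θ : Matrix ι κ F} {h : A * Bᵀ = 0} {k : Fin n} {e : (κ → F) × F × (κ → F)} :
    e ∈ (bcjrTrellis A B Θ h).edges k ↔ ∃ u : ι → F, e = (u ᵥ* bcjrLabels A B Θ k.castSucc,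
      u ⬝ᵥ (fun i => A i k), u ᵥ* bcjrLabels A B Θ k.succ) :=
  ⟨fun ⟨u, hu⟩ => ⟨u, hu.symm⟩, fun ⟨u, hu⟩ => ⟨u, hu.symm⟩⟩

theorem mem_V_bcjrTrellis [Fintype ι] {A : Matrix ι (Fin n) F} {B : Matrix κ (Fin n) F}
    {Θ : Matrix ι κ F} {h : A * Bᵀ = 0} {k : Fin (n + 1)} {v : κ → F} :
    v ∈ (bcjrTrellis A B Θ h).V k ↔ ∃ u : ι → F, v = u ᵥ* bcjrLabels A B Θ k :=
  ⟨fun ⟨u, hu⟩ => ⟨u, hu.symm⟩, fun ⟨u, hu⟩ => ⟨u, hu.symm⟩⟩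

/-- An edge orthogonality for a rank one update `N'` of `N`: solutions `x₁`, `x₂` for the two end
points of an edge can be replaced by a common solution `x`. The hypothesis `hk` provides a row of
`N` showing that `p` is not in the column space of `N`, or a column of `N'` showing that `q` is not
in the row space of `N'`. -/
theorem exists_common_mulVec [Fintype κ] {N N' : Matrix ι κ F} {p : ι → F} {q : κ → F}
    (hN : ∀ x, N' *ᵥ x = N *ᵥ x + (q ⬝ᵥ x) • p)
    (hk : (∃ i, N i = 0 ∧ p i ≠ 0) ∨ ∃ j, (∀ i, N' i j = 0) ∧ q j ≠ 0)
    {x₁ x₂ : κ → F} {d : F} (h : N *ᵥ x₁ + d • p = N' *ᵥ x₂) :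
    ∃ x, N *ᵥ x = N *ᵥ x₁ ∧ q ⬝ᵥ x = d ∧ N' *ᵥ x = N' *ᵥ x₂ := by
  classical
  rcases hk with ⟨i, hi, hpi⟩ | ⟨j, hj, hqj⟩
  · refine ⟨x₂, ?_⟩
    rw [hN] at h
    have hd : q ⬝ᵥ x₂ = d := by
      have h' := congrFun h i
      have hz : ∀ x, (N *ᵥ x) i = 0 := fun x => by simp [mulVec, hi]
      simp only [Pi.add_apply, hz, Pi.smul_apply, smul_eq_mul, zero_add] at h'
      exact (mul_right_cancel₀ hpi h').symm
    rw [hd] at h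
    exact ⟨(add_right_cancel h).symm, hd, rfl⟩
  · -- The vector `z` satisfies `N' z = 0` and `q ⬝ᵥ z = 1`.
    set z : κ → F := Pi.single j (q j)⁻¹ with hz
    have hz1 : q ⬝ᵥ z = 1 := by simp [hz, hqj]
    have hz2 : N' *ᵥ z = 0 := by
      funext i
      simp [hz, mulVec, hj]
    have hx : N' *ᵥ (x₂ + (d - q ⬝ᵥ x₂) • z) = N' *ᵥ x₂ := by
      rw [mulVec_add, mulVec_smul, hz2, smul_zero, add_zero]
    have hd : q ⬝ᵥ (x₂ + (d - q ⬝ᵥ x₂) • z) = d := by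
      rw [dotProduct_add, dotProduct_smul, hz1, smul_eq_mul, mul_one, add_sub_cancel]
    refine ⟨x₂ + (d - q ⬝ᵥ x₂) • z, ?_, hd, hx⟩
    have hx' := hx
    rw [hN, hd, ← h] at hx'
    exact add_right_cancel hx'

/-- The BCJR trellises for `A` and `B` with displacement matrices `Θ` and `Θᵀ` are dual, if at each
time `k` there is a path of the first trellis with label zero at time `k` and nonzero edge label, or
a path of the second trellis with label zero at time `k + 1` and nonzero edge label. -/
theorem isDual_bcjrTrellis [Fintype ι] [Fintype κ] {A : Matrix ι (Fin n) F}
    {B : Matrix κ (Fin n) F} {Θ : Matrix ι κ F} (h : A * Bᵀ = 0) (h' : B * Aᵀ = 0)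
    (hk : ∀ k : Fin n, (∃ i, bcjrLabels A B Θ k.castSucc i = 0 ∧ A i k ≠ 0) ∨
      ∃ j, (∀ i, bcjrLabels A B Θ k.succ i j = 0) ∧ B j k ≠ 0) :
    (bcjrTrellis A B Θ h).IsDual (bcjrTrellis B A Θᵀ h') := by
  -- The pairing depends on the label matrix only, so that it is the same at times `0` and `n`.
  choose β hβ using fun N : Matrix ι κ F => exists_pairing_vecMul_mulVec N
  refine ⟨fun k => β (bcjrLabels A B Θ k), ?_, ?_, ?_, ?_⟩
  · exact congrArg β (bcjrLabels_last A B Θ h)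
  · intro k v hv hvw
    obtain ⟨u, rfl⟩ := mem_V_bcjrTrellis.1 hv
    refine dotProduct_eq_zero _ fun x => ?_
    rw [← dotProduct_mulVec, ← hβ]
    exact hvw _ (mem_V_bcjrTrellis.2
      ⟨x, by rw [bcjrLabels_transpose, vecMul_transpose]⟩)
  · intro k w hw hvw
    obtain ⟨x, rfl⟩ := mem_V_bcjrTrellis.1 hw
    rw [bcjrLabels_transpose, vecMul_transpose] at hvw ⊢
    refine dotProduct_eq_zero _ fun u => ?_
    rw [dotProduct_comm, ← hβ]
    exact hvw _ (mem_V_bcjrTrellis.2 ⟨u, rfl⟩)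
  · intro k e'
    have hN : ∀ x, bcjrLabels A B Θ k.succ *ᵥ x = bcjrLabels A B Θ k.castSucc *ᵥ x +
        ((fun j => B j k) ⬝ᵥ x) • fun i => A i k := by
      intro x
      funext i
      simp only [mulVec, dotProduct, bcjrLabels_succ, Pi.add_apply, Pi.smul_apply, smul_eq_mul,
        add_mul, Finset.sum_add_distrib, Finset.sum_mul]
      congr 1
      exact Finset.sum_congr rfl fun j _ => by ring
    constructor
    · intro he'
      refine ⟨LinearTrellis.source_mem _ k e' he', LinearTrellis.target_mem _ k e' he', ?_⟩
      intro e he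
      obtain ⟨u, rfl⟩ := mem_edges_bcjrTrellis.1 he
      obtain ⟨x, rfl⟩ := mem_edges_bcjrTrellis.1 he'
      simp only [bcjrLabels_transpose, vecMul_transpose, hβ]
      simp only [hN, dotProduct_add, dotProduct_smul, smul_eq_mul, dotProduct_comm x]
      ring
    · rintro ⟨h1, h2, horth⟩
      obtain ⟨w, d, w'⟩ := e'
      obtain ⟨x₁, hx₁⟩ := mem_V_bcjrTrellis.1 h1
      obtain ⟨x₂, hx₂⟩ := mem_V_bcjrTrellis.1 h2
      rw [bcjrLabels_transpose, vecMul_transpose] at hx₁ hx₂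
      dsimp only at hx₁ hx₂
      subst hx₁ hx₂
      have heq : bcjrLabels A B Θ k.castSucc *ᵥ x₁ + d • (fun i => A i k) =
          bcjrLabels A B Θ k.succ *ᵥ x₂ := by
        refine dotProduct_eq _ _ fun u => ?_
        have hu := horth _ (mem_edges_bcjrTrellis.2 ⟨u, rfl⟩)
        simp only [hβ] at hu
        rw [dotProduct_comm, dotProduct_comm _ u, dotProduct_add, dotProduct_smul, smul_eq_mul,
          ← sub_eq_zero, ← hu]
        ring
      obtain ⟨x, hx, hxd, hx'⟩ := exists_common_mulVec hN (hk k) heq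
      refine mem_edges_bcjrTrellis.2 ⟨x, ?_⟩
      rw [bcjrLabels_transpose, bcjrLabels_transpose, vecMul_transpose, vecMul_transpose, hx, hx',
        dotProduct_comm, hxd]

end LocalDuality

/-! ### Displacement matrices for characteristic matrices in duality -/

section Displacement

variable {F : Type*} [Field F] {n : ℕ} {X Y : Matrix (Fin n) (Fin n) F}

theorem InDuality.thetaX_eq (hd : InDuality X Y) (h0 : X * Yᵀ = 0) (I J : Finset (Fin n)) :
    thetaX X Y I J = -(minorOf (displacementE X Y) J I)ᵀ := by
  ext i j
  have h : (strictLowerPart X * Yᵀ) i j = displacementE X Y j i :=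
    congrFun (congrFun (hd.strictLowerPart_mul h0) i) j
  simp [thetaX, spanDisplacement, rowsOf, minorOf, ← h, mul_apply, strictLowerPart, ite_mul]

theorem mul_lowerPart_apply (X Y : Matrix (Fin n) (Fin n) F) (i j : Fin n) :
    (X * (lowerPart Y)ᵀ) i j = ∑ l, if l ≤ j then X i l * Y j l else 0 := by
  simp [mul_apply, lowerPart]

theorem InDuality.thetaY_eq (hd : InDuality X Y) (h0 : X * Yᵀ = 0) {a : Fin n → Fin n}
    (hY : ∀ j, HasSpan (Y j) (a j) j) (I J : Finset (Fin n)) :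
    thetaY X Y a I J = (minorOf (displacementD X Y) I J)ᵀ := by
  ext j i
  have h : (X * (lowerPart Y)ᵀ) i j = -displacementD X Y i j :=
    congrFun (congrFun (hd.mul_lowerPart h0) i) j
  rw [mul_lowerPart_apply] at h
  have hspan := (hY j).2.2
  have hsum : (∑ l, if l < a j then Y j l * X i l else 0) =
      ∑ l, if l ≤ (j : Fin n) then X i l * Y j l else 0 := by
    rcases le_or_gt (a j) j with haj | haj
    · -- Both sides vanish: the left one is a sum before the span, the right one is the full sum.
      trans 0
      · refine Finset.sum_eq_zero fun l _ => ?_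
        split_ifs with hl
        · rw [hspan l hl.ne, zero_mul]
          unfold InCyclicIoc
          grind
        · rfl
      · have h0' : (X * Yᵀ) i j = 0 := congrFun (congrFun h0 i) j
        rw [mul_apply] at h0'
        refine Eq.trans h0'.symm ?_
        refine Finset.sum_congr rfl fun l _ => ?_
        split_ifs with hl
        · rfl
        · rw [transpose_apply, hspan l (by grind), mul_zero]
          unfold InCyclicIoc
          grind
    · refine Finset.sum_congr rfl fun l _ => ?_
      by_cases hl : l ≤ (j : Fin n)
      · rw [if_pos hl, if_pos (hl.trans_lt haj), mul_comm]
      · rw [if_neg hl]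
        split_ifs with hla
        · rw [hspan l hla.ne, zero_mul]
          unfold InCyclicIoc
          grind
        · rfl
  simp [thetaY, spanDisplacement, rowsOf, minorOf, hsum, h]

/-- The matrices `Eᵀ` and `-D` agree off the diagonal. -/
theorem InDuality.minorOf_displacementE (hd : InDuality X Y) (I : Finset (Fin n)) :
    (minorOf (displacementE X Y) Iᶜ I)ᵀ = -minorOf (displacementD X Y) I Iᶜ := by
  ext i j
  have hij : (i : Fin n) ≠ j := fun h => Finset.mem_compl.1 j.2 (h ▸ i.2)
  have h : displacementD X Y i j + displacementE X Y j i = (1 : Matrix (Fin n) (Fin n) F) i j :=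
    congrFun (congrFun hd.displacementD_add i) j
  rw [one_apply_ne hij] at h
  exact eq_neg_of_add_eq_zero_right h

/-- The label at time `j + 1` of the path for row `j` of `Y` is zero. -/
theorem InDuality.bcjrLabels_succ_eq_zero (hd : InDuality X Y) (h0 : X * Yᵀ = 0)
    (I : Finset (Fin n)) (i : I) (j : (Iᶜ : Finset (Fin n))) :
    bcjrLabels (rowsOf X I) (rowsOf Y Iᶜ) (thetaX X Y I Iᶜ) (j : Fin n).succ i j = 0 := by
  have h : (X * (lowerPart Y)ᵀ) i j = -displacementD X Y i j :=
    congrFun (congrFun (hd.mul_lowerPart h0) i) j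
  rw [mul_lowerPart_apply] at h
  rw [hd.thetaX_eq h0, hd.minorOf_displacementE, neg_neg]
  simp [bcjrLabels, rowsOf, minorOf, Fin.castSucc_lt_succ_iff, h]

end Displacement

theorem theoremT {F : Type*} [Field F] {n r s : ℕ}
    (G : Matrix (Fin r) (Fin n) F) (H : Matrix (Fin s) (Fin n) F)
    (hGH : MaximalOrthogonal G H)
    (X Y : Matrix (Fin n) (Fin n) F) (a b : Fin n → Fin n)
    (hX : IsLeftOrderedCharacteristic (rowSpace G) X b)
    (hY : IsRightOrderedCharacteristic (rowSpace H) Y a)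
    (hXY : InDuality X Y) (I : Finset (Fin n)) :
    -- rank duality
    (IsRowBasis X I ↔ IsRowBasis Y Iᶜ) ∧
    -- the two span based BCJR trellises are in duality
    (IsRowBasis X I →
      IsSpanLabeling (rowsOf X I) (rowsOf Y Iᶜ) (fun i => (i : Fin n)) (fun i => b i)
        (bcjrLabels (rowsOf X I) (rowsOf Y Iᶜ) (thetaX X Y I Iᶜ)) ∧
      IsSpanLabeling (rowsOf Y Iᶜ) (rowsOf X I) (fun j => a j) (fun j => (j : Fin n))
        (bcjrLabels (rowsOf Y Iᶜ) (rowsOf X I) (thetaY X Y a I Iᶜ)) ∧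
      -- duality of the displacement matrices
      thetaX X Y I Iᶜ = -(minorOf (displacementE X Y) Iᶜ I).transpose ∧
      thetaY X Y a I Iᶜ = (minorOf (displacementD X Y) I Iᶜ).transpose ∧
      (minorOf (displacementE X Y) Iᶜ I).transpose = -minorOf (displacementD X Y) I Iᶜ ∧
      thetaY X Y a I Iᶜ = (thetaX X Y I Iᶜ).transpose ∧
      -- local duality of the trellises
      (bcjrTrellis (rowsOf X I) (rowsOf Y Iᶜ) (thetaX X Y I Iᶜ)
          (rowsOf_mul_transpose hGH hX hY I Iᶜ)).IsDual
        (bcjrTrellis (rowsOf Y Iᶜ) (rowsOf X I) (thetaY X Y a I Iᶜ)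
          (rowsOf_mul_transpose' hGH hX hY I Iᶜ))) := by
  have h0 : X * Yᵀ = 0 := by
    ext i j
    exact (hGH (Y j)).1 (hY.mem j) (X i) (hX.mem i)
  have hθ : thetaY X Y a I Iᶜ = (thetaX X Y I Iᶜ)ᵀ := by
    rw [hXY.thetaY_eq h0 hY.hasSpan, hXY.thetaX_eq h0, hXY.minorOf_displacementE, neg_neg]
  refine ⟨hXY.isRowBasis_iff h0 I, fun _ => ⟨?_, ?_, hXY.thetaX_eq h0 I Iᶜ,
    hXY.thetaY_eq h0 hY.hasSpan I Iᶜ, hXY.minorOf_displacementE I, hθ, ?_⟩⟩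
  · exact isSpanLabeling_bcjrLabels (rowsOf_mul_transpose hGH hX hY I Iᶜ)
      fun i => hX.hasSpan i
  · exact isSpanLabeling_bcjrLabels (rowsOf_mul_transpose' hGH hX hY I Iᶜ)
      fun j => hY.hasSpan j
  · simp only [hθ]
    refine isDual_bcjrTrellis _ _ fun k => ?_
    by_cases hk : k ∈ I
    · refine Or.inl ⟨⟨k, hk⟩, ?_, (hX.hasSpan k).1⟩
      funext j
      simp [bcjrLabels, thetaX, spanDisplacement]
    · have hk' := Finset.mem_compl.2 hk
      exact Or.inr ⟨⟨k, hk'⟩, fun i => hXY.bcjrLabels_succ_eq_zero h0 I i ⟨k, hk'⟩,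
        (hY.hasSpan k).2.1⟩
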